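/- For an integer $n\ge 1$ let $$\lambda_n=\sum_{\rho}\Bigl[1-\Bigl(1-\frac1\rho\Bigr)^{n}\Bigr]=\lim_{T\to\infty}\ \sum_{|\operatorname{Im}\rho|\le T}\Bigl[1-\Bigl(1-\frac1\rho\Bigr)^{n}\Bigr]$$ be the $n$-th Li coefficient, where $\rho$ runs over the nontrivial zeros of the Riemann zeta function, counted with multiplicity. Assume the Riemann hypothesis. Then the limits defining $\lambda_n$ exist for all $n\ge 1$, and for all $n\ge 3$ $$|\lambda_n+\lambda_{n-2}-2\lambda_{n-1}|\le 2+\gamma-\log 4\pi,$$ where $\gamma$ is the Euler(–Mascheroni) constant. Moreover $2+\gamma-\log 4\pi=0.04619\cdots$, that is, $0.04619\le 2+\gamma-\log 4\pi<0.04620$. -/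

import Mathlib

open Filter Topology

/-- The nontrivial zeros of the Riemann zeta function: all zeros other than the negative even
integers. (Mathlib assigns a nonzero value to `riemannZeta` at its pole `1`, so `1` is not an
element of this set.) -/
def nontrivialZetaZeros : Set ℂ :=
  {ρ : ℂ | riemannZeta ρ = 0 ∧ ¬ ∃ n : ℕ, ρ = -2 * ((n : ℂ) + 1)}

/-- Every nontrivial zero lies in the open critical strip. -/
theorem nontrivialZetaZeros_re_mem {ρ : ℂ} (hρ : ρ ∈ nontrivialZetaZeros) :
    0 < ρ.re ∧ ρ.re < 1 := by
  obtain ⟨h0, hnt⟩ := hρ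
  have hlt : ρ.re < 1 := by
    by_contra! h
    exact riemannZeta_ne_zero_of_one_le_re h h0
  refine ⟨?_, hlt⟩
  by_contra! hre
  have hne0 : ρ ≠ 0 := by
    rintro rfl
    rw [riemannZeta_zero] at h0
    norm_num at h0
  have hG : Complex.Gammaℝ ρ ≠ 0 := by
    intro hG
    obtain ⟨m, hm⟩ := Complex.Gammaℝ_eq_zero_iff.mp hG
    rcases m with _ | m
    · exact hne0 (by simpa using hm)
    · exact hnt ⟨m, by rw [hm]; push_cast; ring⟩
  have hΛ : completedRiemannZeta ρ = 0 := by
    rw [riemannZeta_def_of_ne_zero hne0] at h0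
    exact (div_eq_zero_iff.mp h0).resolve_right hG
  have hne1 : 1 - ρ ≠ 0 := by
    intro h
    have := congrArg Complex.re h
    simp at this
    linarith
  refine riemannZeta_ne_zero_of_one_le_re (s := 1 - ρ) (by simpa using hre) ?_
  rw [riemannZeta_def_of_ne_zero hne1, completedRiemannZeta_one_sub, hΛ, zero_div]

/-- There are finitely many nontrivial zeros `ρ` with `|Im ρ| ≤ T`. -/
theorem finite_nontrivialZetaZeros_abs_im_le (T : ℝ) :
    {ρ : ℂ | ρ ∈ nontrivialZetaZeros ∧ |ρ.im| ≤ T}.Finite := by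
  have hK : IsCompact (Set.Icc (0 : ℝ) 1 ×ℂ Set.Icc (-T) T) := isCompact_Icc.reProdIm isCompact_Icc
  refine hK.inter_riemannZetaZeros_finite.subset ?_
  rintro ρ ⟨hρ, hT⟩
  obtain ⟨h1, h2⟩ := nontrivialZetaZeros_re_mem hρ
  exact ⟨⟨⟨h1.le, h2.le⟩, abs_le.mp hT⟩, hρ.1⟩

/-- The partial sum `∑_{|Im ρ| ≤ T} [1 - (1 - 1/ρ)^n]` over the nontrivial zeros `ρ` of the Riemann
zeta function, each zero counted with its multiplicity (its order as a zero of `ζ`). -/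
noncomputable def liPartialSum (n : ℕ) (T : ℝ) : ℂ :=
  ∑ ρ ∈ (finite_nontrivialZetaZeros_abs_im_le T).toFinset,
    (analyticOrderNatAt riemannZeta ρ : ℂ) * (1 - (1 - 1 / ρ) ^ n)

/-- The Li coefficient `λ_n = ∑_ρ [1 - (1 - 1/ρ)^n]`, the sum being the limit as `T → ∞` of the
partial sums over `|Im ρ| ≤ T`. -/
noncomputable def liCoefficient (n : ℕ) : ℂ :=
  limUnder atTop (liPartialSum n)

/-! ### Zeros and logarithmic derivatives of entire functions -/

theorem exists_eq_pow_analyticOrderNatAt_mul {f : ℂ → ℂ} (hf : Differentiable ℂ f) {a : ℂ}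
    (ha : analyticOrderAt f a ≠ ⊤) :
    ∃ h : ℂ → ℂ, Differentiable ℂ h ∧ h a ≠ 0 ∧
      ∀ z, f z = (z - a) ^ analyticOrderNatAt f a * h z := by
  have hfa : AnalyticAt ℂ f a := hf.analyticAt a
  obtain ⟨g, hg, hga, hfg⟩ :=
    (hfa.analyticOrderAt_eq_natCast (n := analyticOrderNatAt f a)).mp
      (Nat.cast_analyticOrderNatAt ha).symm
  set m := analyticOrderNatAt f a
  classical
  set h : ℂ → ℂ := fun z ↦ if z = a then g a else f z / (z - a) ^ m with hh
  have hev : h =ᶠ[𝓝 a] g := by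
    filter_upwards [hfg] with z hz
    by_cases hza : z = a
    · simp [hh, hza]
    · have : z - a ≠ 0 := sub_ne_zero.mpr hza
      simp only [hh, if_neg hza, hz, smul_eq_mul]
      field_simp
  refine ⟨h, fun z ↦ ?_, by simpa [hh] using hga, fun z ↦ ?_⟩
  · by_cases hza : z = a
    · subst hza
      exact hg.differentiableAt.congr_of_eventuallyEq hev
    · have h1 : DifferentiableAt ℂ (fun z ↦ f z / (z - a) ^ m) z :=
        (hf z).div (by fun_prop) (pow_ne_zero _ (sub_ne_zero.mpr hza))
      refine h1.congr_of_eventuallyEq ?_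
      filter_upwards [isOpen_ne.mem_nhds hza] with w hw
      simp [hh, show w ≠ a from hw]
  · by_cases hza : z = a
    · subst hza
      simpa [hh] using hfg.self_of_nhds
    · have : z - a ≠ 0 := sub_ne_zero.mpr hza
      simp only [hh, if_neg hza]
      field_simp

theorem analyticOrderAt_ne_top_of_differentiable {f : ℂ → ℂ} (hf : Differentiable ℂ f) {b : ℂ}
    (hb : f b ≠ 0) (a : ℂ) : analyticOrderAt f a ≠ ⊤ := by
  have hA : AnalyticOnNhd ℂ f Set.univ := fun z _ ↦ hf.analyticAt z
  refine hA.analyticOrderAt_ne_top_of_isPreconnected isPreconnected_univ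
    (Set.mem_univ b) (Set.mem_univ a) ?_
  rw [analyticOrderAt_eq_zero.mpr (Or.inr hb)]
  simp

theorem exists_eq_prod_pow_analyticOrderNatAt_mul {f : ℂ → ℂ} (hf : Differentiable ℂ f) {b : ℂ}
    (hb : f b ≠ 0) (Z : Finset ℂ) :
    ∃ h : ℂ → ℂ, Differentiable ℂ h ∧ (∀ a ∈ Z, h a ≠ 0) ∧
      ∀ z, f z = (∏ a ∈ Z, (z - a) ^ analyticOrderNatAt f a) * h z := by
  classical
  induction Z using Finset.induction_on with
  | empty => exact ⟨f, hf, by simp, by simp⟩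
  | insert a Z haZ ih =>
    obtain ⟨h, hd, hne, hfh⟩ := ih
    have hhb : h b ≠ 0 := fun h0 ↦ hb (by rw [hfh, h0, mul_zero])
    -- The factors already removed do not vanish at `a`, so the order there is unchanged.
    have hord : analyticOrderNatAt f a = analyticOrderNatAt h a := by
      have hP : Differentiable ℂ (fun z : ℂ ↦ ∏ a ∈ Z, (z - a) ^ analyticOrderNatAt f a) := by
        fun_prop
      have hPa : (fun z : ℂ ↦ ∏ c ∈ Z, (z - c) ^ analyticOrderNatAt f c) a ≠ 0 :=
        Finset.prod_ne_zero_iff.mpr fun c hc ↦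
          pow_ne_zero _ (sub_ne_zero.mpr (by rintro rfl; exact haZ hc))
      have h1 := analyticOrderAt_mul (hP.analyticAt a) (hd.analyticAt a)
      rw [(hP.analyticAt a).analyticOrderAt_eq_zero.mpr hPa, zero_add] at h1
      have h2 : f = (fun z : ℂ ↦ ∏ a ∈ Z, (z - a) ^ analyticOrderNatAt f a) * h := by
        ext z; exact hfh z
      rw [← h2] at h1
      simp [analyticOrderNatAt, h1]
    obtain ⟨k, hkd, hka, hhk⟩ := exists_eq_pow_analyticOrderNatAt_mul hd
      (analyticOrderAt_ne_top_of_differentiable hd hhb a)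
    refine ⟨k, hkd, ?_, fun z ↦ ?_⟩
    · intro c hc
      rcases Finset.mem_insert.mp hc with rfl | hc
      · exact hka
      · intro h0
        exact hne c hc (by rw [hhk, h0, mul_zero])
    · rw [Finset.prod_insert haZ, hfh z, hhk z, hord]
      ring

/-- `L` is a primitive of h'/h on the disc; then h · exp(-L) has derivative zero. -/
theorem exists_log_of_ne_zero_on_ball {h : ℂ → ℂ} (hd : Differentiable ℂ h) {R : ℝ} (hR : 0 < R)
    (hne : ∀ z ∈ Metric.ball (0 : ℂ) R, h z ≠ 0) :
    ∃ L : ℂ → ℂ, L 0 = 0 ∧ (∀ z ∈ Metric.ball (0 : ℂ) R, HasDerivAt L (logDeriv h z) z) ∧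
      ∀ z ∈ Metric.ball (0 : ℂ) R, h z = h 0 * Complex.exp (L z) := by
  have hd' : Differentiable ℂ (deriv h) := hd.deriv
  have h1 : DifferentiableOn ℂ (logDeriv h) (Metric.ball 0 R) := fun z hz ↦
    ((hd' z).div (hd z) (hne z hz)).differentiableWithinAt
  obtain ⟨L, hL0, hL⟩ := h1.isExactOn_ball.with_val_at 0 0
  refine ⟨L, hL0, hL, fun z hz ↦ ?_⟩
  have hder : ∀ w ∈ Metric.ball (0 : ℂ) R,
      HasDerivAt (fun z ↦ h z * Complex.exp (-L z)) 0 w := by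
    intro w hw
    have := (hd w).hasDerivAt.mul ((hL w hw).neg.cexp)
    refine this.congr_deriv ?_
    have := hne w hw
    simp only [logDeriv_apply, Pi.neg_apply]
    field_simp
    ring
  have hc := Metric.isOpen_ball.is_const_of_deriv_eq_zero
    (convex_ball (0 : ℂ) R).isPreconnected
    (fun w hw ↦ (hder w hw).differentiableAt.differentiableWithinAt)
    (fun w hw ↦ (hder w hw).deriv) hz (Metric.mem_ball_self hR)
  simp only [hL0, neg_zero, Complex.exp_zero, mul_one] at hc
  rw [← hc, mul_assoc, ← Complex.exp_add]
  simp

/-- A consequence of the Borel–Carathéodory inequality for the logarithm of a function without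
zeros in a disc. -/
theorem norm_logDeriv_sub_logDeriv_le {h : ℂ → ℂ} (hd : Differentiable ℂ h) {R M : ℝ}
    (hR : 4 < R) (hM : 0 < M) (hne : ∀ z ∈ Metric.ball (0 : ℂ) R, h z ≠ 0)
    (hb : ∀ z ∈ Metric.ball (0 : ℂ) R, ‖h z‖ ≤ ‖h 0‖ * Real.exp M) :
    ‖logDeriv h 1 - logDeriv h 0‖ ≤ 64 * M / R ^ 2 := by
  have hR0 : 0 < R := by linarith
  obtain ⟨L, hL0, hL, hexp⟩ := exists_log_of_ne_zero_on_ball hd hR0 hne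
  have hh0 : 0 < ‖h 0‖ := norm_pos_iff.mpr (hne 0 (Metric.mem_ball_self hR0))
  have hre : Set.MapsTo L (Metric.ball 0 R) {z | z.re ≤ M} := by
    intro z hz
    have h1 := hb z hz
    rw [hexp z hz, norm_mul, Complex.norm_exp] at h1
    exact Real.exp_le_exp.mp (le_of_mul_le_mul_left h1 hh0)
  have hLd : DifferentiableOn ℂ L (Metric.ball 0 R) := fun z hz ↦
    (hL z hz).differentiableAt.differentiableWithinAt
  -- Borel–Carathéodory gives 2M‖z‖/(R - ‖z‖), at most 2M on the half disc.
  have hLb : ∀ z : ℂ, ‖z‖ ≤ R / 2 → ‖L z‖ ≤ 2 * M := by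
    intro z hz
    have hzR : z ∈ Metric.ball (0 : ℂ) R := by
      rw [mem_ball_zero_iff]; linarith
    refine (Complex.borelCaratheodory_zero hM hLd hre hR0 hzR hL0).trans ?_
    rw [div_le_iff₀ (by linarith)]
    nlinarith
  -- Cauchy's estimate for L' on circles of radius R/4, which stay in the half disc.
  have hL' : ∀ z ∈ Metric.ball (0 : ℂ) (R / 4), ‖logDeriv h z‖ ≤ 8 * M / R := by
    intro z hz
    rw [mem_ball_zero_iff] at hz
    have hsub : Metric.closedBall z (R / 4) ⊆ Metric.ball 0 R := by
      intro w hw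
      rw [mem_closedBall_iff_norm] at hw
      rw [mem_ball_zero_iff]
      calc ‖w‖ = ‖(w - z) + z‖ := by simp
        _ ≤ ‖w - z‖ + ‖z‖ := norm_add_le _ _
        _ < R := by linarith
    have h1 := Complex.norm_deriv_le_of_forall_mem_sphere_norm_le (c := z) (R := R / 4)
      (C := 2 * M) (f := L) (by linarith) ((hLd.mono hsub).diffContOnCl_ball subset_rfl) ?_
    · rw [(hL z (by rw [mem_ball_zero_iff]; linarith)).deriv] at h1
      refine h1.trans_eq ?_
      field_simp
      norm_num
    · intro w hw
      refine hLb w ?_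
      rw [mem_sphere_iff_norm] at hw
      calc ‖w‖ = ‖(w - z) + z‖ := by simp
        _ ≤ ‖w - z‖ + ‖z‖ := norm_add_le _ _
        _ ≤ R / 2 := by linarith
  have hdl : DifferentiableOn ℂ (logDeriv h) (Metric.ball 0 (R / 4)) := fun z hz ↦
    (((hd.deriv) z).div (hd z)
      (hne z (Metric.ball_subset_ball (by linarith) hz))).differentiableWithinAt
  have hmaps : Set.MapsTo (logDeriv h) (Metric.ball 0 (R / 4))
      (Metric.closedBall (logDeriv h 0) (16 * M / R)) := by
    intro z hz
    rw [mem_closedBall_iff_norm]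
    refine (norm_sub_le _ _).trans ?_
    have h1 := hL' z hz
    have h2 := hL' 0 (Metric.mem_ball_self (by linarith))
    have h3 : 16 * M / R = 8 * M / R + 8 * M / R := by ring
    linarith
  -- Schwarz's lemma on the disc of radius R/4, which contains 1 because R > 4.
  have hfin := Complex.dist_le_div_mul_dist_of_mapsTo_ball hdl hmaps (z := 1)
    (by rw [mem_ball_zero_iff, norm_one]; linarith)
  rw [dist_eq_norm, dist_zero_right, norm_one, mul_one] at hfin
  refine hfin.trans_eq ?_
  field_simp
  norm_num

/-- Write f = P h with P carrying the zeros in |z| ≤ R; the error is the change of h'/h from 0 to 1.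
The growth hypothesis sits on |z| = 2R because there |z - a| ≥ R ≥ |a| for each zero `a` of P. Hence
|P(z)| ≥ |P(0)|, and h inherits the bound for f. -/
theorem norm_sum_zeros_sub_logDeriv_le {f : ℂ → ℂ} (hf : Differentiable ℂ f) (h0 : f 0 ≠ 0)
    (h1 : f 1 ≠ 0) {R M : ℝ} (hR : 4 < R) (hM : 0 < M)
    (hb : ∀ z : ℂ, ‖z‖ = 2 * R → ‖f z‖ ≤ ‖f 0‖ * Real.exp M) {Z : Finset ℂ}
    (hZ : ∀ a, a ∈ Z ↔ f a = 0 ∧ ‖a‖ ≤ R) :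
    ‖∑ a ∈ Z, (analyticOrderNatAt f a : ℂ) * (1 / (1 - a) + 1 / a) -
      (logDeriv f 1 - logDeriv f 0)‖ ≤ 64 * M / R ^ 2 := by
  obtain ⟨h, hd, hne, hfh⟩ := exists_eq_prod_pow_analyticOrderNatAt_mul hf h0 Z
  set m := analyticOrderNatAt f
  set P : ℂ → ℂ := fun z ↦ ∏ a ∈ Z, (z - a) ^ m a with hP
  have hfP : f = fun z ↦ P z * h z := funext hfh
  have hPd : Differentiable ℂ P := by simp only [hP]; fun_prop
  have hlog : ∀ w, f w ≠ 0 →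
      logDeriv f w = ∑ a ∈ Z, (m a : ℂ) * (1 / (w - a)) + logDeriv h w := by
    intro w hw
    have hw' := hfh w
    have hPw : P w ≠ 0 := fun h ↦ hw (by rw [hw']; simp only [hP] at h; rw [h, zero_mul])
    have hhw : h w ≠ 0 := fun h ↦ hw (by rw [hw', h, mul_zero])
    rw [hfP, logDeriv_mul w hPw hhw (hPd w) (hd w)]
    congr 1
    simp only [hP]
    rw [logDeriv_prod]
    · refine Finset.sum_congr rfl fun a _ ↦ ?_
      rw [logDeriv_fun_pow (by fun_prop), logDeriv_apply]
      simp
    · exact fun a ha ↦ Finset.prod_ne_zero_iff.mp hPw a ha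
    · intro a _; fun_prop
  have hsum : ∑ a ∈ Z, (m a : ℂ) * (1 / (1 - a) + 1 / a) - (logDeriv f 1 - logDeriv f 0) =
      -(logDeriv h 1 - logDeriv h 0) := by
    rw [hlog 1 h1, hlog 0 h0]
    have : ∑ a ∈ Z, (m a : ℂ) * (1 / (1 - a) + 1 / a) =
        ∑ a ∈ Z, (m a : ℂ) * (1 / (1 - a)) - ∑ a ∈ Z, (m a : ℂ) * (1 / (0 - a)) := by
      rw [← Finset.sum_sub_distrib]
      refine Finset.sum_congr rfl fun a _ ↦ ?_
      rw [zero_sub, one_div (-a), inv_neg]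
      ring
    rw [this]
    ring
  rw [hsum, norm_neg]
  have hnz : ∀ z : ℂ, ‖z‖ ≤ R → h z ≠ 0 := by
    intro z hz hz0
    exact hne z ((hZ z).mpr ⟨by rw [hfh, hz0, mul_zero], hz⟩) hz0
  have hsphere : ∀ z : ℂ, ‖z‖ = 2 * R → ‖h z‖ ≤ ‖h 0‖ * Real.exp M := by
    intro z hz
    have hPle : ‖P 0‖ ≤ ‖P z‖ := by
      simp only [hP, norm_prod, norm_pow]
      refine Finset.prod_le_prod (fun _ _ ↦ by positivity) fun a ha ↦ ?_
      have := ((hZ a).mp ha).2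
      gcongr
      rw [zero_sub, norm_neg]
      have := norm_sub_norm_le z a
      linarith
    have hP0 : P 0 ≠ 0 := fun h ↦ h0 (by rw [hfh]; simp only [hP] at h; rw [h, zero_mul])
    have hP0' : 0 < ‖P 0‖ := norm_pos_iff.mpr hP0
    have h2 := hb z hz
    rw [hfP] at h2
    simp only [norm_mul] at h2
    have h3 : ‖P 0‖ * ‖h z‖ ≤ ‖P 0‖ * (‖h 0‖ * Real.exp M) := by
      calc ‖P 0‖ * ‖h z‖ ≤ ‖P z‖ * ‖h z‖ := by gcongr
        _ ≤ _ := by rw [← mul_assoc]; exact h2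
    exact le_of_mul_le_mul_left h3 hP0'
  refine norm_logDeriv_sub_logDeriv_le hd hR hM
    (fun z hz ↦ hnz z (mem_ball_zero_iff.mp hz).le) fun z hz ↦ ?_
  -- The maximum principle carries the bound from the circle of radius 2R into the disc of radius R.
  refine Complex.norm_le_of_forall_mem_frontier_norm_le (U := Metric.ball 0 (2 * R))
    Metric.isBounded_ball hd.diffContOnCl ?_ (subset_closure ?_)
  · intro w hw
    rw [frontier_ball _ (by linarith)] at hw
    exact hsphere w (mem_sphere_zero_iff_norm.mp hw)
  · exact Metric.ball_subset_ball (by linarith) hz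

/-! ### Growth of the completed zeta function -/

/-- Λ₀(s) is half an everywhere convergent Mellin transform at s/2. The modulus of its integrand
depends only on Re s and is dominated by the sum of the integrands at the ends 1/4 and 1 of the
range of Re(s/2). -/
theorem exists_norm_completedRiemannZeta₀_le_of_re_mem_Icc :
    ∃ K : ℝ, 0 ≤ K ∧ ∀ s : ℂ, 1 / 2 ≤ s.re → s.re ≤ 2 → ‖completedRiemannZeta₀ s‖ ≤ K := by
  set F : ℝ → ℂ := (HurwitzZeta.hurwitzEvenFEPair 0).f_modif with hF
  have hconv : ∀ w : ℂ, MellinConvergent F w := fun w ↦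
    ((HurwitzZeta.hurwitzEvenFEPair 0).isStrongFEPair_toStrongFEPair.hasMellin w).1
  have hnorm : ∀ w : ℂ, ∀ t ∈ Set.Ioi (0 : ℝ), ‖(t : ℂ) ^ (w - 1) • F t‖ =
      t ^ (w.re - 1) * ‖F t‖ := by
    intro w t ht
    rw [norm_smul, Complex.norm_cpow_eq_rpow_re_of_pos ht]
    simp
  set G : ℝ → ℝ := fun t ↦ ‖(t : ℂ) ^ ((1 / 4 : ℂ) - 1) • F t‖ + ‖(t : ℂ) ^ ((1 : ℂ) - 1) • F t‖
  have hG : MeasureTheory.IntegrableOn G (Set.Ioi 0) :=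
    (hconv (1 / 4)).norm.add (hconv 1).norm
  refine ⟨∫ t in Set.Ioi 0, G t, MeasureTheory.integral_nonneg fun t ↦ by positivity,
    fun s h1 h2 ↦ ?_⟩
  have hbd : ‖mellin F (s / 2)‖ ≤ ∫ t in Set.Ioi 0, G t := by
    refine MeasureTheory.norm_integral_le_of_norm_le hG ?_
    filter_upwards [MeasureTheory.ae_restrict_mem measurableSet_Ioi] with t ht
    have ht0 : 0 < t := ht
    simp only [G, hnorm _ t ht]
    rw [← add_mul]
    gcongr
    have hre : (s / 2).re = s.re / 2 := by simp
    have hre' : ((1 / 4 : ℂ)).re = 1 / 4 := by norm_num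
    rw [hre, hre', Complex.one_re]
    rcases le_total t 1 with h | h
    · have := Real.rpow_le_rpow_of_exponent_ge ht0 h
        (show (1 / 4 : ℝ) - 1 ≤ s.re / 2 - 1 by linarith)
      exact le_add_of_le_of_nonneg this (Real.rpow_nonneg ht0.le _)
    · have := Real.rpow_le_rpow_of_exponent_le h
        (show s.re / 2 - 1 ≤ (1 : ℝ) - 1 by linarith)
      exact le_add_of_nonneg_of_le (Real.rpow_nonneg ht0.le _) this
  have : completedRiemannZeta₀ s = mellin F (s / 2) / 2 := rfl
  rw [this, norm_div]
  have := norm_nonneg (mellin F (s / 2))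
  norm_num
  linarith

theorem Complex.norm_Gamma_le_Gamma_re {s : ℂ} (hs : 0 < s.re) :
    ‖Complex.Gamma s‖ ≤ Real.Gamma s.re := by
  rw [Complex.Gamma_eq_integral hs, Real.Gamma_eq_integral hs]
  refine MeasureTheory.norm_integral_le_of_norm_le (Real.GammaIntegral_convergent hs) ?_
  filter_upwards [MeasureTheory.ae_restrict_mem measurableSet_Ioi] with t ht
  rw [norm_mul, Complex.norm_cpow_eq_rpow_re_of_pos ht, Complex.norm_real, Real.norm_eq_abs,
    abs_of_pos (Real.exp_pos _)]
  simp

theorem Real.Gamma_le_exp_mul_log {x : ℝ} (hx : 1 ≤ x) :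
    Real.Gamma x ≤ Real.exp ((x + 2) * Real.log (x + 2)) := by
  -- Monotonicity of Γ is available only on [2, ∞), hence the shift by one.
  have h1 : Real.Gamma x ≤ Real.Gamma (x + 1) := by
    rw [Real.Gamma_add_one (by linarith)]
    nlinarith [Real.Gamma_pos_of_pos (show 0 < x by linarith)]
  have hc := Nat.le_ceil x
  have hc' := Nat.ceil_lt_add_one (show 0 ≤ x by linarith)
  set n := ⌈x⌉₊ + 1 with hn
  have hnx : x + 1 ≤ n := by rw [hn]; push_cast; linarith
  have hnx' : (n : ℝ) ≤ x + 2 := by rw [hn]; push_cast; linarith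
  have h2 : Real.Gamma (x + 1) ≤ Real.Gamma (n + 1) :=
    Real.Gamma_strictMonoOn_Ici.monotoneOn (Set.mem_Ici.mpr (by linarith))
      (Set.mem_Ici.mpr (by linarith)) (by linarith)
  rw [Real.Gamma_nat_eq_factorial] at h2
  have h3 : ((n.factorial : ℕ) : ℝ) ≤ (n : ℝ) ^ n := by exact_mod_cast Nat.factorial_le_pow n
  have hnpos : (0 : ℝ) < n := by linarith
  have h4 : (n : ℝ) ^ n = Real.exp (n * Real.log n) := by
    rw [Real.exp_nat_mul, Real.exp_log hnpos]
  have h5 : (n : ℝ) * Real.log n ≤ (x + 2) * Real.log (x + 2) := by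
    have := Real.log_le_log hnpos hnx'
    have h6 : 0 ≤ Real.log n := Real.log_nonneg (by linarith)
    gcongr
  linarith [Real.exp_le_exp.mpr h5]

theorem exists_norm_completedRiemannZeta₀_le_of_two_le_re :
    ∃ K : ℝ, 0 ≤ K ∧ ∀ s : ℂ, 2 ≤ s.re →
      ‖completedRiemannZeta₀ s‖ ≤ K * Real.exp ((‖s‖ + 2) * Real.log (‖s‖ + 2)) := by
  have hsum : Summable fun n : ℕ ↦ 1 / (n : ℝ) ^ (2 : ℝ) :=
    Real.summable_one_div_nat_rpow.mpr (by norm_num)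
  have hS0 : 0 ≤ ∑' n : ℕ, 1 / (n : ℝ) ^ (2 : ℝ) := tsum_nonneg fun n ↦ by positivity
  refine ⟨∑' n : ℕ, 1 / (n : ℝ) ^ (2 : ℝ) + 2, by linarith, fun s hs ↦ ?_⟩
  have hsn : s.re ≤ ‖s‖ := Complex.re_le_norm s
  set E := Real.exp ((‖s‖ + 2) * Real.log (‖s‖ + 2))
  have hE1 : 1 ≤ E := Real.one_le_exp (mul_nonneg (by linarith) (Real.log_nonneg (by linarith)))
  have hz : ‖∑' n : ℕ, 1 / (n : ℂ) ^ s‖ ≤ ∑' n : ℕ, 1 / (n : ℝ) ^ (2 : ℝ) := by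
    refine tsum_of_norm_bounded hsum.hasSum fun n ↦ ?_
    rcases Nat.eq_zero_or_pos n with rfl | hn
    · have : s ≠ 0 := by rintro rfl; norm_num at hs
      simp [Complex.zero_cpow this]
    · rw [norm_div, norm_one, Complex.norm_natCast_cpow_of_pos hn]
      have : (1 : ℝ) ≤ n := by exact_mod_cast hn
      gcongr
  have hre : (s / 2).re = s.re / 2 := by simp
  have hΓ : ‖Complex.Gamma (s / 2)‖ ≤ E := by
    refine (Complex.norm_Gamma_le_Gamma_re (by rw [hre]; linarith)).trans ?_
    rw [hre]
    refine (Real.Gamma_le_exp_mul_log (by linarith)).trans (Real.exp_le_exp.mpr ?_)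
    have h1 : Real.log (s.re / 2 + 2) ≤ Real.log (‖s‖ + 2) :=
      Real.log_le_log (by linarith) (by linarith)
    have h2 : 0 ≤ Real.log (s.re / 2 + 2) := Real.log_nonneg (by linarith)
    have h3 : s.re / 2 + 2 ≤ ‖s‖ + 2 := by linarith
    gcongr
  have hπ : ‖(Real.pi : ℂ) ^ (-s / 2)‖ ≤ 1 := by
    rw [Complex.norm_cpow_eq_rpow_re_of_pos Real.pi_pos]
    refine Real.rpow_le_one_of_one_le_of_nonpos (by linarith [Real.pi_gt_three]) ?_
    have : (-s / 2).re = -s.re / 2 := by simp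
    rw [this]
    linarith
  have hΛ : ‖completedRiemannZeta s‖ ≤ E * ∑' n : ℕ, 1 / (n : ℝ) ^ (2 : ℝ) := by
    rw [completedZeta_eq_tsum_of_one_lt_re (by linarith), norm_mul, norm_mul]
    calc _ ≤ 1 * E * ∑' n : ℕ, 1 / (n : ℝ) ^ (2 : ℝ) := by gcongr
      _ = _ := by ring
  have h1 : ‖1 / s‖ ≤ 1 := by
    rw [norm_div, norm_one, div_le_one (by linarith)]
    linarith
  have h2 : ‖1 / (1 - s)‖ ≤ 1 := by
    have : 1 ≤ ‖1 - s‖ := by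
      have := Complex.abs_re_le_norm (1 - s)
      rw [Complex.sub_re, Complex.one_re, abs_of_nonpos (by linarith)] at this
      linarith
    rw [norm_div, norm_one, div_le_one (by linarith)]
    exact this
  have heq : completedRiemannZeta₀ s = completedRiemannZeta s + 1 / s + 1 / (1 - s) := by
    rw [completedRiemannZeta_eq]; ring
  rw [heq]
  refine (norm_add₃_le).trans ?_
  nlinarith

/-- The functional equation reflects Re s ≤ 1/2 into the right half-plane; ‖1 - s‖ ≤ ‖s‖ + 1 turns
the 2 into 3. -/
theorem exists_norm_completedRiemannZeta₀_le :
    ∃ K : ℝ, 0 ≤ K ∧ ∀ s : ℂ,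
      ‖completedRiemannZeta₀ s‖ ≤ K * Real.exp ((‖s‖ + 3) * Real.log (‖s‖ + 3)) := by
  obtain ⟨K₁, hK₁, h₁⟩ := exists_norm_completedRiemannZeta₀_le_of_re_mem_Icc
  obtain ⟨K₂, hK₂, h₂⟩ := exists_norm_completedRiemannZeta₀_le_of_two_le_re
  have hright : ∀ s : ℂ, 1 / 2 ≤ s.re → ‖completedRiemannZeta₀ s‖ ≤
      (K₁ + K₂) * Real.exp ((‖s‖ + 2) * Real.log (‖s‖ + 2)) := by
    intro s hs
    have hE1 : 1 ≤ Real.exp ((‖s‖ + 2) * Real.log (‖s‖ + 2)) :=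
      Real.one_le_exp (mul_nonneg (by positivity)
        (Real.log_nonneg (by linarith [norm_nonneg s])))
    rcases le_total s.re 2 with h | h
    · have := h₁ s hs h
      nlinarith
    · have := h₂ s h
      nlinarith
  have hmono : ∀ a b : ℝ, 0 ≤ a → a + 2 ≤ b →
      Real.exp ((a + 2) * Real.log (a + 2)) ≤ Real.exp (b * Real.log b) := by
    intro a b ha hab
    have := Real.log_le_log (by linarith) hab
    have h2 : 0 ≤ Real.log (a + 2) := Real.log_nonneg (by linarith)
    refine Real.exp_le_exp.mpr ?_
    have : 0 ≤ b := by linarith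
    gcongr
  refine ⟨K₁ + K₂, by linarith, fun s ↦ ?_⟩
  rcases le_total (1 / 2) s.re with h | h
  · refine (hright s h).trans ?_
    have := hmono ‖s‖ (‖s‖ + 3) (norm_nonneg _) (by linarith)
    gcongr
  · rw [← completedRiemannZeta₀_one_sub]
    refine (hright (1 - s) (by simp; linarith)).trans ?_
    have := hmono ‖1 - s‖ (‖s‖ + 3) (norm_nonneg _) (by
      have := norm_sub_le 1 s
      rw [norm_one] at this
      linarith)
    gcongr

/-! ### The entire function ξ and its zeros -/

/-- The entire function `1 + s (s - 1) Λ₀(s)`, which is `s (s - 1) Λ(s)` away from `0` and `1`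
(twice Riemann's `ξ`). -/
noncomputable def entireXi (s : ℂ) : ℂ := 1 + s * (s - 1) * completedRiemannZeta₀ s

theorem differentiable_entireXi : Differentiable ℂ entireXi := by
  have := differentiable_completedZeta₀
  unfold entireXi
  fun_prop

@[simp] theorem entireXi_zero : entireXi 0 = 1 := by simp [entireXi]

@[simp] theorem entireXi_one : entireXi 1 = 1 := by simp [entireXi]

theorem entireXi_one_sub (s : ℂ) : entireXi (1 - s) = entireXi s := by
  simp only [entireXi, completedRiemannZeta₀_one_sub]
  ring

theorem hasDerivAt_entireXi (s : ℂ) :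
    HasDerivAt entireXi ((2 * s - 1) * completedRiemannZeta₀ s +
      s * (s - 1) * deriv completedRiemannZeta₀ s) s := by
  have h := (((hasDerivAt_id s).mul ((hasDerivAt_id s).sub_const 1)).mul
    (differentiable_completedZeta₀ s).hasDerivAt).const_add 1
  refine h.congr_deriv ?_
  simp only [id, Pi.mul_apply]
  ring

/-- As `entireXi` is 1 at both points, the logarithmic derivatives are Λ₀(1) and -Λ₀(0), and Λ₀(0) =
Λ₀(1). The difference is 2Λ₀(1), whose value is known. -/
theorem logDeriv_entireXi_one_sub_zero :
    logDeriv entireXi 1 - logDeriv entireXi 0 =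
      ((2 + Real.eulerMascheroniConstant - Real.log (4 * Real.pi) : ℝ) : ℂ) := by
  rw [logDeriv_apply, logDeriv_apply, (hasDerivAt_entireXi 1).deriv, (hasDerivAt_entireXi 0).deriv]
  have h0 : completedRiemannZeta₀ 0 = completedRiemannZeta₀ 1 := by
    rw [← completedRiemannZeta₀_one_sub]; simp
  have hlog : ((Real.log (4 * Real.pi) : ℝ) : ℂ) = Complex.log (4 * Real.pi) := by
    rw [Complex.ofReal_log (by positivity)]; push_cast; rfl
  rw [h0, completedRiemannZeta₀_one]
  push_cast
  rw [← hlog]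
  simp
  ring

theorem exists_norm_entireXi_le :
    ∃ C : ℝ, 0 ≤ C ∧ ∀ s : ℂ,
      ‖entireXi s‖ ≤ Real.exp (C + (‖s‖ + 5) * Real.log (‖s‖ + 3)) := by
  obtain ⟨K, hK, h⟩ := exists_norm_completedRiemannZeta₀_le
  refine ⟨Real.log (1 + K), Real.log_nonneg (by linarith), fun s ↦ ?_⟩
  have hs := norm_nonneg s
  set r := ‖s‖ + 3 with hr
  set E := Real.exp (r * Real.log r) with hE
  have hE1 : 1 ≤ E := Real.one_le_exp (mul_nonneg (by linarith) (Real.log_nonneg (by linarith)))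
  have hrhs : Real.exp (Real.log (1 + K) + (‖s‖ + 5) * Real.log r) = (1 + K) * (r ^ 2 * E) := by
    rw [show (‖s‖ + 5) * Real.log r = (2 : ℕ) * Real.log r + r * Real.log r by
      rw [hr]; push_cast; ring, Real.exp_add, Real.exp_add, Real.exp_nat_mul,
      Real.exp_log (by linarith), Real.exp_log (by linarith)]
  rw [hrhs]
  have h1 : ‖entireXi s‖ ≤ 1 + r ^ 2 * (K * E) := by
    refine (norm_add_le _ _).trans ?_
    rw [norm_one, norm_mul, norm_mul]
    have h2 : ‖s - 1‖ ≤ r := by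
      have := norm_sub_le s 1
      rw [norm_one] at this
      linarith
    have h3 : ‖s‖ ≤ r := by linarith
    have := h s
    rw [sq]
    gcongr
  nlinarith [one_le_pow₀ (show 1 ≤ r by linarith) (n := 2), 
    mul_nonneg hK (by positivity : 0 ≤ r ^ 2 * E)]

theorem entireXi_eq_mul_riemannZeta {s : ℂ} (h0 : s ≠ 0) (h1 : s ≠ 1) :
    entireXi s = s * (s - 1) * completedRiemannZeta s := by
  have h1' : 1 - s ≠ 0 := sub_ne_zero.mpr h1.symm
  rw [completedRiemannZeta_eq, entireXi]
  field_simp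
  ring

theorem riemannZeta_eq_mul_entireXi {s : ℂ} (h0 : s ≠ 0) (h1 : s ≠ 1) :
    riemannZeta s = (s * (s - 1))⁻¹ * (Complex.Gammaℝ s)⁻¹ * entireXi s := by
  have h1' : s - 1 ≠ 0 := sub_ne_zero.mpr h1
  rw [riemannZeta_def_of_ne_zero h0, entireXi_eq_mul_riemannZeta h0 h1]
  field_simp

theorem entireXi_eq_zero_iff (ρ : ℂ) : entireXi ρ = 0 ↔ ρ ∈ nontrivialZetaZeros := by
  constructor
  · intro h
    have h0 : ρ ≠ 0 := by rintro rfl; simp at h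
    have h1 : ρ ≠ 1 := by rintro rfl; simp at h
    refine ⟨by rw [riemannZeta_eq_mul_entireXi h0 h1, h, mul_zero], ?_⟩
    rintro ⟨n, rfl⟩
    -- A trivial zero reflects to a point of real part at least 3, where ζ does not vanish.
    rw [← entireXi_one_sub] at h
    set s : ℂ := 1 - -2 * ((n : ℂ) + 1) with hs
    have hsre : s.re = 2 * n + 3 := by simp [hs]; ring
    have hs1 : 1 ≤ s.re := by rw [hsre]; linarith [(Nat.cast_nonneg n : (0 : ℝ) ≤ n)]
    have hs0 : s ≠ 0 := by
      intro h; rw [h] at hs1; norm_num at hs1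
    have hs1' : s ≠ 1 := by
      intro h
      rw [h, Complex.one_re] at hsre
      linarith [(Nat.cast_nonneg n : (0 : ℝ) ≤ n)]
    refine riemannZeta_ne_zero_of_one_le_re hs1 ?_
    rw [riemannZeta_eq_mul_entireXi hs0 hs1', h, mul_zero]
  · intro h
    obtain ⟨hre0, hre1⟩ := nontrivialZetaZeros_re_mem h
    have h0 : ρ ≠ 0 := by rintro rfl; simp at hre0
    have h1 : ρ ≠ 1 := by rintro rfl; simp at hre1
    have h1' : ρ - 1 ≠ 0 := sub_ne_zero.mpr h1
    have hz := h.1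
    rw [riemannZeta_eq_mul_entireXi h0 h1] at hz
    have hG := Complex.Gammaℝ_ne_zero_of_re_pos hre0
    exact (mul_eq_zero.mp hz).resolve_left
      (mul_ne_zero (inv_ne_zero (mul_ne_zero h0 h1')) (inv_ne_zero hG))

theorem analyticOrderNatAt_riemannZeta_eq {ρ : ℂ} (h : ρ ∈ nontrivialZetaZeros) :
    analyticOrderNatAt riemannZeta ρ = analyticOrderNatAt entireXi ρ := by
  obtain ⟨hre0, hre1⟩ := nontrivialZetaZeros_re_mem h
  have h0 : ρ ≠ 0 := by rintro rfl; simp at hre0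
  have h1 : ρ ≠ 1 := by rintro rfl; simp at hre1
  have h1' : ρ - 1 ≠ 0 := sub_ne_zero.mpr h1
  have hG := Complex.Gammaℝ_ne_zero_of_re_pos hre0
  set k : ℂ → ℂ := fun s ↦ (s * (s - 1))⁻¹ * (Complex.Gammaℝ s)⁻¹ with hk
  have hkρ : k ρ ≠ 0 := mul_ne_zero (inv_ne_zero (mul_ne_zero h0 h1')) (inv_ne_zero hG)
  have hka : AnalyticAt ℂ k ρ := by
    refine AnalyticAt.mul (AnalyticAt.inv (by fun_prop) (mul_ne_zero h0 h1')) ?_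
    exact Complex.differentiable_Gammaℝ_inv.analyticAt ρ
  have hev : riemannZeta =ᶠ[𝓝 ρ] k * entireXi := by
    filter_upwards [isOpen_ne.mem_nhds h0, isOpen_ne.mem_nhds h1] with s hs0 hs1
    exact riemannZeta_eq_mul_entireXi hs0 hs1
  have := analyticOrderAt_congr hev
  rw [analyticOrderAt_mul hka (differentiable_entireXi.analyticAt ρ),
    hka.analyticOrderAt_eq_zero.mpr hkρ, zero_add] at this
  simp [analyticOrderNatAt, this]

theorem analyticOrderNatAt_entireXi_one_sub (ρ : ℂ) :
    analyticOrderNatAt entireXi (1 - ρ) = analyticOrderNatAt entireXi ρ := by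
  have hd : HasDerivAt (fun s : ℂ ↦ 1 - s) (-1) ρ := (hasDerivAt_id ρ).const_sub 1
  have h := analyticOrderAt_comp_of_deriv_ne_zero (f := entireXi) (g := fun s : ℂ ↦ 1 - s)
    (z₀ := ρ) (by fun_prop) (by rw [hd.deriv]; simp)
  have hc : entireXi ∘ (fun s : ℂ ↦ 1 - s) = entireXi := funext entireXi_one_sub
  rw [hc] at h
  simp [analyticOrderNatAt, h]

theorem one_sub_mem_nontrivialZetaZeros {ρ : ℂ} (h : ρ ∈ nontrivialZetaZeros) :
    1 - ρ ∈ nontrivialZetaZeros := by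
  rw [← entireXi_eq_zero_iff] at h ⊢
  rw [entireXi_one_sub, h]

theorem analyticOrderNatAt_riemannZeta_one_sub {ρ : ℂ} (h : ρ ∈ nontrivialZetaZeros) :
    analyticOrderNatAt riemannZeta (1 - ρ) = analyticOrderNatAt riemannZeta ρ := by
  rw [analyticOrderNatAt_riemannZeta_eq h,
    analyticOrderNatAt_riemannZeta_eq (one_sub_mem_nontrivialZetaZeros h),
    analyticOrderNatAt_entireXi_one_sub]

theorem finite_nontrivialZetaZeros_norm_le (R : ℝ) :
    {ρ : ℂ | ρ ∈ nontrivialZetaZeros ∧ ‖ρ‖ ≤ R}.Finite :=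
  (finite_nontrivialZetaZeros_abs_im_le R).subset fun ρ h ↦
    ⟨h.1, (Complex.abs_im_le_norm ρ).trans h.2⟩

/-! ### The sum over the zeros -/

theorem tendsto_add_mul_log_add_div_sq (C : ℝ) :
    Tendsto (fun R : ℝ ↦ (C + (2 * R + 5) * Real.log (2 * R + 3)) / R ^ 2) atTop (𝓝 0) := by
  have hlog : (fun R : ℝ ↦ Real.log (2 * R + 3)) =o[atTop] fun R ↦ R := by
    have h1 : Tendsto (fun R : ℝ ↦ 2 * R + 3) atTop atTop :=
      tendsto_atTop_add_const_right _ _ (tendsto_id.const_mul_atTop (by norm_num))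
    refine (Real.isLittleO_log_id_atTop.comp_tendsto h1).trans_isBigO ?_
    refine Asymptotics.IsBigO.of_bound 5 ?_
    filter_upwards [eventually_ge_atTop 1] with R hR
    simp only [Function.comp, id, Real.norm_eq_abs]
    rw [abs_of_nonneg (by linarith), abs_of_nonneg (by linarith)]
    linarith
  have hlin : (fun R : ℝ ↦ 2 * R + 5) =O[atTop] fun R ↦ R := by
    refine Asymptotics.IsBigO.of_bound 7 ?_
    filter_upwards [eventually_ge_atTop 1] with R hR
    simp only [Real.norm_eq_abs]
    rw [abs_of_nonneg (by linarith), abs_of_nonneg (by linarith)]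
    linarith
  have h1 : (fun R : ℝ ↦ (2 * R + 5) * Real.log (2 * R + 3)) =o[atTop] fun R ↦ R ^ 2 := by
    simpa only [sq] using hlin.mul_isLittleO hlog
  have h2 : (fun _ : ℝ ↦ C) =o[atTop] fun R : ℝ ↦ R ^ 2 := by
    refine Asymptotics.isLittleO_const_left.mpr (Or.inr ?_)
    exact tendsto_norm_atTop_atTop.comp (tendsto_pow_atTop (by norm_num))
  exact (h2.add h1).tendsto_div_nhds_zero

/-- The value of `∑ 1 / (ρ (1 - ρ))` over the nontrivial zeros, summed by absolute value. -/
theorem tendsto_sum_nontrivialZetaZeros :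
    Tendsto (fun R : ℝ ↦ ∑ ρ ∈ (finite_nontrivialZetaZeros_norm_le R).toFinset,
      (analyticOrderNatAt riemannZeta ρ : ℂ) * (1 / (1 - ρ) + 1 / ρ)) atTop
      (𝓝 ((2 + Real.eulerMascheroniConstant - Real.log (4 * Real.pi) : ℝ) : ℂ)) := by
  obtain ⟨C, hC, hbd⟩ := exists_norm_entireXi_le
  rw [tendsto_iff_norm_sub_tendsto_zero]
  have hlim := (tendsto_add_mul_log_add_div_sq C).const_mul 64
  rw [mul_zero] at hlim
  refine squeeze_zero' (Eventually.of_forall fun _ ↦ norm_nonneg _) ?_ hlim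
  filter_upwards [eventually_gt_atTop 4] with R hR
  have hlogpos : 0 < Real.log (2 * R + 3) := Real.log_pos (by linarith)
  have h := norm_sum_zeros_sub_logDeriv_le differentiable_entireXi (by simp) (by simp) hR
    (M := C + (2 * R + 5) * Real.log (2 * R + 3)) (by positivity)
    (fun z hz ↦ by
      have := hbd z
      rw [hz] at this
      simpa using this)
    (Z := (finite_nontrivialZetaZeros_norm_le R).toFinset)
    (fun a ↦ by simp [entireXi_eq_zero_iff])
  rw [logDeriv_entireXi_one_sub_zero] at h
  rw [← mul_div_assoc]
  rwa [Finset.sum_congr rfl fun ρ hρ ↦ by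
    rw [analyticOrderNatAt_riemannZeta_eq ((Set.Finite.mem_toFinset _).mp hρ).1]]

/-! ### Li coefficients under the Riemann hypothesis -/

theorem RiemannHypothesis.re_eq_half (hRH : RiemannHypothesis) {ρ : ℂ}
    (h : ρ ∈ nontrivialZetaZeros) : ρ.re = 1 / 2 := by
  refine hRH ρ h.1 h.2 ?_
  rintro rfl
  have := (nontrivialZetaZeros_re_mem h).2
  simp at this

theorem one_sub_eq_conj_of_re_eq_half {ρ : ℂ} (h : ρ.re = 1 / 2) :
    1 - ρ = (starRingEnd ℂ) ρ := by
  apply Complex.ext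
  · simp [h]; norm_num
  · simp

theorem one_div_one_sub_add_one_div_eq {ρ : ℂ} (h : ρ.re = 1 / 2) :
    1 / (1 - ρ) + 1 / ρ = ((1 / ‖ρ‖ ^ 2 : ℝ) : ℂ) := by
  have hρ : ρ ≠ 0 := by rintro rfl; norm_num at h
  have hconj := one_sub_eq_conj_of_re_eq_half h
  have h1 : 1 - ρ ≠ 0 := by rw [hconj]; simpa using hρ
  have h2 : ((‖ρ‖ : ℂ)) ^ 2 = (1 - ρ) * ρ := by
    rw [hconj, mul_comm, Complex.mul_conj, Complex.normSq_eq_norm_sq]; push_cast; rfl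
  push_cast
  rw [h2]
  field_simp
  ring

theorem sum_order_div_norm_sq_le (hRH : RiemannHypothesis) {S : Finset ℂ}
    (hS : ∀ ρ ∈ S, ρ ∈ nontrivialZetaZeros) :
    ∑ ρ ∈ S, (analyticOrderNatAt riemannZeta ρ : ℝ) * (1 / ‖ρ‖ ^ 2) ≤
      2 + Real.eulerMascheroniConstant - Real.log (4 * Real.pi) := by
  have hlim : Tendsto (fun R : ℝ ↦ ∑ ρ ∈ (finite_nontrivialZetaZeros_norm_le R).toFinset,
      (analyticOrderNatAt riemannZeta ρ : ℝ) * (1 / ‖ρ‖ ^ 2)) atTop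
      (𝓝 (2 + Real.eulerMascheroniConstant - Real.log (4 * Real.pi))) := by
    have h := (Complex.continuous_re.tendsto _).comp tendsto_sum_nontrivialZetaZeros
    rw [Complex.ofReal_re] at h
    refine h.congr fun R ↦ ?_
    simp only [Function.comp]
    rw [Complex.re_sum]
    refine Finset.sum_congr rfl fun ρ hρ ↦ ?_
    rw [one_div_one_sub_add_one_div_eq (hRH.re_eq_half ((Set.Finite.mem_toFinset _).mp hρ).1)]
    rw [← Complex.ofReal_natCast, ← Complex.ofReal_mul, Complex.ofReal_re]
  refine ge_of_tendsto hlim ?_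
  -- A disc of this radius contains `S`, and all terms are nonnegative.
  filter_upwards [eventually_ge_atTop (∑ ρ ∈ S, ‖ρ‖)] with R hR
  refine Finset.sum_le_sum_of_subset_of_nonneg (fun ρ hρ ↦ ?_) fun _ _ _ ↦ by positivity
  rw [Set.Finite.mem_toFinset]
  exact ⟨hS ρ hρ, (Finset.single_le_sum (f := fun ρ : ℂ ↦ ‖ρ‖)
    (fun _ _ ↦ norm_nonneg _) hρ).trans hR⟩

theorem norm_one_sub_one_div_eq_one {ρ : ℂ} (h : ρ.re = 1 / 2) : ‖1 - 1 / ρ‖ = 1 := by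
  have hρ : ρ ≠ 0 := by rintro rfl; norm_num at h
  have hn : ‖ρ‖ ≠ 0 := norm_ne_zero_iff.mpr hρ
  have h1 : 1 - 1 / ρ = -(1 - ρ) / ρ := by field_simp; ring
  rw [h1, norm_div, norm_neg, one_sub_eq_conj_of_re_eq_half h, Complex.norm_conj, div_self hn]

theorem norm_pow_sub_one_le {u : ℂ} (hu : ‖u‖ = 1) (n : ℕ) : ‖u ^ n - 1‖ ≤ n * ‖u - 1‖ := by
  rw [← geom_sum_mul, norm_mul]
  gcongr
  refine (norm_sum_le _ _).trans ?_
  simp [hu]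

/-- The numbers u, v attached to ρ and 1 - ρ satisfy uv = 1, so the sum is -(uⁿ - 1)² vⁿ, and |uⁿ -
1| ≤ n|u - 1| = n/|ρ|. -/
theorem norm_li_term_add_li_term_one_sub_le {ρ : ℂ} (h : ρ.re = 1 / 2) (n : ℕ) :
    ‖(1 - (1 - 1 / ρ) ^ n) + (1 - (1 - 1 / (1 - ρ)) ^ n)‖ ≤ n ^ 2 * (1 / ‖ρ‖ ^ 2) := by
  have hρ : ρ ≠ 0 := by rintro rfl; norm_num at h
  have h1 : 1 - ρ ≠ 0 := by rw [one_sub_eq_conj_of_re_eq_half h]; simpa using hρ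
  have hu := norm_one_sub_one_div_eq_one h
  have hv : ‖1 - 1 / (1 - ρ)‖ = 1 := norm_one_sub_one_div_eq_one (by simp [h]; norm_num)
  have huv : (1 - 1 / ρ) * (1 - 1 / (1 - ρ)) = 1 := by field_simp; ring
  have hsub : ‖1 - 1 / ρ - 1‖ = 1 / ‖ρ‖ := by simp
  set u := 1 - 1 / ρ
  set v := 1 - 1 / (1 - ρ)
  have huvn : u ^ n * v ^ n = 1 := by rw [← mul_pow, huv, one_pow]
  have heq : (1 - u ^ n) + (1 - v ^ n) = -((u ^ n - 1) ^ 2 * v ^ n) := by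
    linear_combination (u ^ n - 2) * huvn
  rw [heq, norm_neg, norm_mul, norm_pow, norm_pow v, hv, one_pow, mul_one]
  calc ‖u ^ n - 1‖ ^ 2 ≤ (n * ‖u - 1‖) ^ 2 := by
        gcongr; exact norm_pow_sub_one_le hu n
    _ = _ := by rw [hsub]; ring

/-- The window |Im ρ| ≤ T and the multiplicities are invariant under ρ ↦ 1 - ρ. Averaging replaces
terms of size 1/|ρ| by terms that are absolutely summable under RH. -/
theorem liPartialSum_eq_sum_symm (n : ℕ) (T : ℝ) :
    liPartialSum n T = ∑ ρ ∈ (finite_nontrivialZetaZeros_abs_im_le T).toFinset,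
      (analyticOrderNatAt riemannZeta ρ : ℂ) *
        (((1 - (1 - 1 / ρ) ^ n) + (1 - (1 - 1 / (1 - ρ)) ^ n)) / 2) := by
  have hmem : ∀ ρ ∈ (finite_nontrivialZetaZeros_abs_im_le T).toFinset,
      1 - ρ ∈ (finite_nontrivialZetaZeros_abs_im_le T).toFinset := by
    intro ρ hρ
    rw [Set.Finite.mem_toFinset] at hρ ⊢
    exact ⟨one_sub_mem_nontrivialZetaZeros hρ.1, by simpa using hρ.2⟩
  have hrefl : liPartialSum n T = ∑ ρ ∈ (finite_nontrivialZetaZeros_abs_im_le T).toFinset,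
      (analyticOrderNatAt riemannZeta ρ : ℂ) * (1 - (1 - 1 / (1 - ρ)) ^ n) := by
    refine Finset.sum_nbij' (fun ρ ↦ 1 - ρ) (fun ρ ↦ 1 - ρ) hmem hmem (by simp) (by simp) ?_
    intro ρ hρ
    rw [analyticOrderNatAt_riemannZeta_one_sub ((Set.Finite.mem_toFinset _).mp hρ).1,
      sub_sub_cancel]
  have h2 : liPartialSum n T = (liPartialSum n T + liPartialSum n T) / 2 := by ring
  rw [h2]
  nth_rw 2 [hrefl]
  rw [liPartialSum, ← Finset.sum_add_distrib, Finset.sum_div]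
  refine Finset.sum_congr rfl fun ρ _ ↦ ?_
  ring

theorem summable_order_div_norm_sq (hRH : RiemannHypothesis) :
    Summable fun ρ : nontrivialZetaZeros ↦
      (analyticOrderNatAt riemannZeta (ρ : ℂ) : ℝ) * (1 / ‖(ρ : ℂ)‖ ^ 2) := by
  refine summable_of_sum_le
    (c := 2 + Real.eulerMascheroniConstant - Real.log (4 * Real.pi))
    (fun _ ↦ by positivity) fun S ↦ ?_
  have h := sum_order_div_norm_sq_le hRH (S := S.map (Function.Embedding.subtype _)) (by
    intro ρ hρ
    obtain ⟨a, _, rfl⟩ := Finset.mem_map.mp hρ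
    exact a.2)
  rwa [Finset.sum_map] at h

theorem tendsto_liPartialSum (hRH : RiemannHypothesis) (n : ℕ) :
    Tendsto (liPartialSum n) atTop (𝓝 (liCoefficient n)) := by
  classical
  refine tendsto_nhds_limUnder ?_
  set b : nontrivialZetaZeros → ℂ := fun ρ ↦ (analyticOrderNatAt riemannZeta (ρ : ℂ) : ℂ) *
    (((1 - (1 - 1 / (ρ : ℂ)) ^ n) + (1 - (1 - 1 / (1 - (ρ : ℂ))) ^ n)) / 2)
  have hb : Summable b := by
    refine Summable.of_norm_bounded ((summable_order_div_norm_sq hRH).mul_left ((n : ℝ) ^ 2 / 2))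
      fun ρ ↦ ?_
    have h := norm_li_term_add_li_term_one_sub_le (hRH.re_eq_half ρ.2) n
    simp only [b]
    rw [norm_mul, norm_div, Complex.norm_natCast, Complex.norm_ofNat]
    calc _ ≤ (analyticOrderNatAt riemannZeta (ρ : ℂ) : ℝ) * (n ^ 2 * (1 / ‖(ρ : ℂ)‖ ^ 2) / 2) := by
          gcongr
      _ = _ := by ring
  set F : ℝ → Finset nontrivialZetaZeros := fun T ↦
    (finite_nontrivialZetaZeros_abs_im_le T).toFinset.subtype (· ∈ nontrivialZetaZeros)
  have hF : Tendsto F atTop atTop := by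
    refine tendsto_atTop_finset_of_monotone (fun T T' hT ρ hρ ↦ ?_) fun ρ ↦ ⟨|(ρ : ℂ).im|, ?_⟩
    · simp only [F, Finset.mem_subtype, Set.Finite.mem_toFinset, Set.mem_ofPred_eq] at hρ ⊢
      exact ⟨hρ.1, hρ.2.trans hT⟩
    · simp [F]
  refine ⟨∑' ρ, b ρ, (hb.hasSum.comp hF).congr fun T ↦ ?_⟩
  rw [liPartialSum_eq_sum_symm]
  simp only [Function.comp, F, b]
  rw [Finset.sum_subtype_of_mem (p := (· ∈ nontrivialZetaZeros)) (fun ρ : ℂ ↦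
    (analyticOrderNatAt riemannZeta ρ : ℂ) *
      (((1 - (1 - 1 / ρ) ^ n) + (1 - (1 - 1 / (1 - ρ)) ^ n)) / 2))]
  exact fun ρ hρ ↦ ((Set.Finite.mem_toFinset _).mp hρ).1

theorem norm_liPartialSum_second_difference_le (hRH : RiemannHypothesis) {n : ℕ} (hn : 2 ≤ n)
    (T : ℝ) :
    ‖liPartialSum n T + liPartialSum (n - 2) T - 2 * liPartialSum (n - 1) T‖ ≤
      2 + Real.eulerMascheroniConstant - Real.log (4 * Real.pi) := by
  obtain ⟨k, rfl⟩ := Nat.exists_eq_add_of_le' hn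
  simp only [Nat.add_sub_cancel, show k + 2 - 1 = k + 1 from rfl]
  have heq : liPartialSum (k + 2) T + liPartialSum k T - 2 * liPartialSum (k + 1) T =
      ∑ ρ ∈ (finite_nontrivialZetaZeros_abs_im_le T).toFinset,
        -((analyticOrderNatAt riemannZeta ρ : ℂ) * ((1 - 1 / ρ) ^ k * (1 / ρ) ^ 2)) := by
    simp only [liPartialSum]
    rw [Finset.mul_sum, ← Finset.sum_add_distrib, ← Finset.sum_sub_distrib]
    refine Finset.sum_congr rfl fun ρ _ ↦ ?_
    ring
  rw [heq]
  have hS : ∀ ρ ∈ (finite_nontrivialZetaZeros_abs_im_le T).toFinset, ρ ∈ nontrivialZetaZeros :=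
    fun ρ hρ ↦ ((Set.Finite.mem_toFinset _).mp hρ).1
  refine (norm_sum_le _ _).trans ((Finset.sum_le_sum fun ρ hρ ↦ ?_).trans
    (sum_order_div_norm_sq_le hRH hS))
  rw [norm_neg, norm_mul, norm_mul, norm_pow,
    norm_one_sub_one_div_eq_one (hRH.re_eq_half (hS ρ hρ)), one_pow, one_mul, norm_pow, norm_div,
    norm_one, Complex.norm_natCast, div_pow, one_pow]

theorem norm_liCoefficient_second_difference_le (hRH : RiemannHypothesis) {n : ℕ} (hn : 2 ≤ n) :
    ‖liCoefficient n + liCoefficient (n - 2) - 2 * liCoefficient (n - 1)‖ ≤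
      2 + Real.eulerMascheroniConstant - Real.log (4 * Real.pi) := by
  have h := (((tendsto_liPartialSum hRH n).add (tendsto_liPartialSum hRH (n - 2))).sub
    ((tendsto_liPartialSum hRH (n - 1)).const_mul 2)).norm
  exact le_of_tendsto' h fun T ↦ norm_liPartialSum_second_difference_le hRH hn T

/-! ### Numerical bounds for γ and log 4π -/

/-- One step of Euler–Maclaurin for 1/x. With y = 1/(2x + 1) the logarithm is log((1 + y)/(1 - y));
three terms of its series exceed the left side by a nonnegative rational function of y. -/
theorem le_log_add_one_sub_log {x : ℝ} (hx : 0 < x) :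
    (1 / x + 1 / (x + 1)) / 2 + (1 / (x + 1) ^ 2 - 1 / x ^ 2) / 12 ≤
      Real.log (x + 1) - Real.log x := by
  set y := 1 / (2 * x + 1) with hy
  have hy0 : 0 < y := by positivity
  have hy1 : y < 1 := by rw [hy, div_lt_one (by positivity)]; linarith
  have hyx : x = (1 - y) / (2 * y) := by rw [hy]; field_simp; ring
  have hyx1 : x + 1 = (1 + y) / (2 * y) := by rw [hy]; field_simp; ring
  have h1y : 0 < 1 - y := by linarith
  have hlog : Real.log (x + 1) - Real.log x = Real.log ((1 + y) / (1 - y)) := by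
    rw [← Real.log_div (by positivity) hx.ne', hyx1, hyx]
    congr 1
    field_simp
  have h := Real.sum_range_le_log_div hy0.le hy1 3
  simp only [Finset.sum_range_succ, Finset.sum_range_zero] at h
  norm_num at h
  have hz : 0 < 1 - y ^ 2 := by nlinarith
  have key : 2 * (y + y ^ 3 / 3 + y ^ 5 / 5) -
      ((1 / x + 1 / (x + 1)) / 2 + (1 / (x + 1) ^ 2 - 1 / x ^ 2) / 12) =
      2 * y * (y ^ 2) ^ 2 * (8 / 15 - y ^ 2 / 15 + (y ^ 2) ^ 2 / 5) / (1 - y ^ 2) ^ 2 := by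
    rw [hyx1, hyx, show 1 - y ^ 2 = (1 - y) * (1 + y) by ring]
    field_simp
    ring
  have hpos : 0 ≤ 2 * y * (y ^ 2) ^ 2 * (8 / 15 - y ^ 2 / 15 + (y ^ 2) ^ 2 / 5) /
      (1 - y ^ 2) ^ 2 := by
    have : 0 ≤ 8 / 15 - y ^ 2 / 15 + (y ^ 2) ^ 2 / 5 := by nlinarith
    positivity
  rw [hlog]
  linarith

theorem log_add_one_sub_log_le {x : ℝ} (hx : 0 < x) :
    Real.log (x + 1) - Real.log x ≤
      (1 / x + 1 / (x + 1)) / 2 + (1 / (x + 1) ^ 2 - 1 / x ^ 2) / 12 -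
        (1 / (x + 1) ^ 4 - 1 / x ^ 4) / 120 := by
  set y := 1 / (2 * x + 1) with hy
  have hy0 : 0 < y := by positivity
  have hy1 : y < 1 := by rw [hy, div_lt_one (by positivity)]; linarith
  have hyx : x = (1 - y) / (2 * y) := by rw [hy]; field_simp; ring
  have hyx1 : x + 1 = (1 + y) / (2 * y) := by rw [hy]; field_simp; ring
  have h1y : 0 < 1 - y := by linarith
  have hlog : Real.log (x + 1) - Real.log x = Real.log ((1 + y) / (1 - y)) := by
    rw [← Real.log_div (by positivity) hx.ne', hyx1, hyx]
    congr 1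
    field_simp
  have h := Real.log_div_le_sum_range_add hy0.le hy1 3
  simp only [Finset.sum_range_succ, Finset.sum_range_zero] at h
  norm_num at h
  have hz : 0 < 1 - y ^ 2 := by nlinarith
  have key : (1 / x + 1 / (x + 1)) / 2 + (1 / (x + 1) ^ 2 - 1 / x ^ 2) / 12 -
        (1 / (x + 1) ^ 4 - 1 / x ^ 4) / 120 -
        2 * (y + y ^ 3 / 3 + y ^ 5 / 5 + y ^ 7 / (1 - y ^ 2)) =
      2 * y * (y ^ 2) ^ 3 * (24 / 15 - 8 / 15 * y ^ 2 +
        (1 - y ^ 2) ^ 2 * (1 / 15 - y ^ 2 / 5) - (1 - y ^ 2) ^ 3) / (1 - y ^ 2) ^ 4 := by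
    rw [hyx1, hyx, show 1 - y ^ 2 = (1 - y) * (1 + y) by ring]
    field_simp
    ring
  have hpos : 0 ≤ 2 * y * (y ^ 2) ^ 3 * (24 / 15 - 8 / 15 * y ^ 2 +
        (1 - y ^ 2) ^ 2 * (1 / 15 - y ^ 2 / 5) - (1 - y ^ 2) ^ 3) / (1 - y ^ 2) ^ 4 := by
    have hfac : 24 / 15 - 8 / 15 * y ^ 2 +
        (1 - y ^ 2) ^ 2 * (1 / 15 - y ^ 2 / 5) - (1 - y ^ 2) ^ 3 =
        24 / 15 - 8 / 15 * y ^ 2 - (1 - y ^ 2) ^ 2 * (14 / 15 - 4 / 5 * y ^ 2) := by ring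
    have h1 : (1 - y ^ 2) ^ 2 ≤ 1 := pow_le_one₀ hz.le (by nlinarith)
    have h2 : (1 - y ^ 2) ^ 2 * (14 / 15 - 4 / 5 * y ^ 2) ≤ 1 * (14 / 15) := by
      refine mul_le_mul h1 (by nlinarith) (by nlinarith) zero_le_one
    have : 0 ≤ 24 / 15 - 8 / 15 * y ^ 2 +
        (1 - y ^ 2) ^ 2 * (1 / 15 - y ^ 2 / 5) - (1 - y ^ 2) ^ 3 := by
      rw [hfac]; nlinarith
    positivity
  rw [hlog]
  linarith

theorem tendsto_harmonic_sub_log_add_mul (a b c : ℝ) :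
    Tendsto (fun n : ℕ ↦ (harmonic n : ℝ) - Real.log n + a / n + b / (n : ℝ) ^ 2 +
      c / (n : ℝ) ^ 4) atTop (𝓝 Real.eulerMascheroniConstant) := by
  have h1 := tendsto_const_div_atTop_nhds_zero_nat a
  have h2 : Tendsto (fun n : ℕ ↦ b / (n : ℝ) ^ 2) atTop (𝓝 0) :=
    tendsto_const_nhds.div_atTop
      ((tendsto_pow_atTop (by norm_num)).comp tendsto_natCast_atTop_atTop)
  have h4 : Tendsto (fun n : ℕ ↦ c / (n : ℝ) ^ 4) atTop (𝓝 0) :=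
    tendsto_const_nhds.div_atTop
      ((tendsto_pow_atTop (by norm_num)).comp tendsto_natCast_atTop_atTop)
  simpa using ((Real.tendsto_harmonic_sub_log.add h1).add h2).add h4

/-- The corrected sequence decreases to γ by `le_log_add_one_sub_log`; with the fourth-order term
added it increases instead. -/
theorem eulerMascheroniConstant_le (n : ℕ) (hn : 1 ≤ n) :
    Real.eulerMascheroniConstant ≤
      harmonic n - Real.log n - 1 / (2 * n) + 1 / (12 * (n : ℝ) ^ 2) := by
  have hlim := tendsto_harmonic_sub_log_add_mul (-1 / 2) (1 / 12) 0
  set s : ℕ → ℝ := fun n ↦ (harmonic n : ℝ) - Real.log n + (-1 / 2) / n + (1 / 12) / (n : ℝ) ^ 2 +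
      0 / (n : ℝ) ^ 4
  have hstep : ∀ m, n ≤ m → s (m + 1) ≤ s m := by
    intro m hm
    have hm0 : (0 : ℝ) < m := by exact_mod_cast (show 0 < m by omega)
    have h := le_log_add_one_sub_log hm0
    simp only [s, harmonic_succ]
    push_cast
    ring_nf at h ⊢
    linarith
  have hle : ∀ m, n ≤ m → s m ≤ s n := fun m hm ↦
    Nat.le_induction le_rfl (fun m hm ih ↦ (hstep m hm).trans ih) m hm
  have h := le_of_tendsto hlim (eventually_atTop.mpr ⟨n, hle⟩)
  refine h.trans_eq ?_
  simp only [s]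
  ring

theorem le_eulerMascheroniConstant (n : ℕ) (hn : 1 ≤ n) :
    harmonic n - Real.log n - 1 / (2 * n) + 1 / (12 * (n : ℝ) ^ 2) - 1 / (120 * (n : ℝ) ^ 4) ≤
      Real.eulerMascheroniConstant := by
  have hlim := tendsto_harmonic_sub_log_add_mul (-1 / 2) (1 / 12) (-1 / 120)
  set s : ℕ → ℝ := fun n ↦ (harmonic n : ℝ) - Real.log n + (-1 / 2) / n + (1 / 12) / (n : ℝ) ^ 2 +
      (-1 / 120) / (n : ℝ) ^ 4
  have hstep : ∀ m, n ≤ m → s m ≤ s (m + 1) := by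
    intro m hm
    have hm0 : (0 : ℝ) < m := by exact_mod_cast (show 0 < m by omega)
    have h := log_add_one_sub_log_le hm0
    simp only [s, harmonic_succ]
    push_cast
    ring_nf at h ⊢
    linarith
  have hle : ∀ m, n ≤ m → s n ≤ s m := fun m hm ↦
    Nat.le_induction le_rfl (fun m hm ih ↦ ih.trans (hstep m hm)) m hm
  have h := ge_of_tendsto hlim (eventually_atTop.mpr ⟨n, hle⟩)
  refine Eq.trans_le ?_ h
  simp only [s]
  ring

theorem harmonic_twenty : harmonic 20 = 55835135 / 15519504 := by
  simp only [harmonic, Finset.sum_range_succ, Finset.sum_range_zero]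
  norm_num

theorem log_eighty_mul_pi_bounds :
    5.526756 ≤ Real.log (80 * Real.pi) ∧ Real.log (80 * Real.pi) ≤ 5.526757 := by
  have hpi1 := Real.pi_gt_d6
  have hpi2 := Real.pi_lt_d6
  have h2 := Real.log_two_gt_d9
  have h2' := Real.log_two_lt_d9
  -- 80π is close to 2⁸: the ratio 256/(80π) is (1 + x)/(1 - x) with x between 0.0092101 and
  -- 0.0092104, so two series terms suffice.
  have h256 : ∀ q : ℝ, 0 < q → Real.log (256 / q) = 8 * Real.log 2 - Real.log q := by
    intro q hq
    rw [Real.log_div (by norm_num) hq.ne', show (256 : ℝ) = 2 ^ 8 by norm_num, Real.log_pow]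
    push_cast
    ring
  constructor
  · have h := Real.log_div_le_sum_range_add (x := 0.0092104) (by norm_num) (by norm_num) 2
    simp only [Finset.sum_range_succ, Finset.sum_range_zero] at h
    have hle := Real.log_le_log (by norm_num)
      (show 256 / ((1 + 0.0092104) / (1 - 0.0092104)) ≤ 80 * Real.pi by
        norm_num at hpi1 ⊢; linarith)
    rw [h256 _ (by norm_num)] at hle
    norm_num at h hle h2 ⊢
    linarith
  · have h := Real.sum_range_le_log_div (x := 0.0092101) (by norm_num) (by norm_num) 2
    simp only [Finset.sum_range_succ, Finset.sum_range_zero] at h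
    have hle := Real.log_le_log (by positivity)
      (show 80 * Real.pi ≤ 256 / ((1 + 0.0092101) / (1 - 0.0092101)) by
        norm_num at hpi2 ⊢; linarith)
    rw [h256 _ (by norm_num)] at hle
    norm_num at h hle h2' ⊢
    linarith

theorem two_add_eulerMascheroniConstant_sub_log_bounds :
    0.04619 ≤ 2 + Real.eulerMascheroniConstant - Real.log (4 * Real.pi) ∧
      2 + Real.eulerMascheroniConstant - Real.log (4 * Real.pi) < 0.04620 := by
  obtain ⟨h1, h2⟩ := log_eighty_mul_pi_bounds
  have hle := eulerMascheroniConstant_le 20 (by norm_num)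
  have hge := le_eulerMascheroniConstant 20 (by norm_num)
  -- The log 20 of the estimates for γ at n = 20 merges with log 4π.
  have hlog : Real.log (80 * Real.pi) = Real.log 20 + Real.log (4 * Real.pi) := by
    rw [← Real.log_mul (by norm_num) (by positivity)]
    congr 1
    ring
  rw [hlog] at h1 h2
  rw [harmonic_twenty] at hle hge
  norm_num at hle hge h1 h2 ⊢
  constructor <;> linarith

/-- Under the Riemann hypothesis, the sums over zeros defining the Li coefficients converge, and
their second differences are at most `2 + γ - log 4π = 0.04619…` in absolute value. -/
theorem corollary3p3 (hRH : RiemannHypothesis) :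
    (∀ n : ℕ, 1 ≤ n → Tendsto (liPartialSum n) atTop (𝓝 (liCoefficient n))) ∧
    (∀ n : ℕ, 3 ≤ n →
      ‖liCoefficient n + liCoefficient (n - 2) - 2 * liCoefficient (n - 1)‖ ≤
        2 + Real.eulerMascheroniConstant - Real.log (4 * Real.pi)) ∧
    (0.04619 ≤ 2 + Real.eulerMascheroniConstant - Real.log (4 * Real.pi) ∧
      2 + Real.eulerMascheroniConstant - Real.log (4 * Real.pi) < 0.04620) :=
  ⟨fun n _ ↦ tendsto_liPartialSum hRH n,
    fun _ hn ↦ norm_liCoefficient_second_difference_le hRH (by omega),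
    two_add_eulerMascheroniConstant_sub_log_bounds⟩
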